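/- All trees are finite, rooted, ordered binary trees in which every inner node has a left and a right subtree; the size of a tree is its number of inner nodes. A rotation replaces, at some inner node of a tree, the subtree at that node of the form $T_1\wedge(T_2\wedge T_3)$ with $(T_1\wedge T_2)\wedge T_3$, or vice versa, where $S\wedge T$ denotes the tree with left subtree $S$ and right subtree $T$. The rotation distance between two trees of the same size is the minimal number of rotations needed to transform one into the other. For $n\ge 1$, let $d(n)$ be the maximum of the rotation distance over all pairs of trees of size $n$; equivalently, $d(n)$ is the diameter of the $n$-th associahedron, that is, the graph whose vertices are the trees of size $n$ and whose edges join two trees that differ by one rotation. Then, for every $n \ge 1$ of the form $n = 2m^2$ with $m$ an integer, $$d(n) \;\ge\; 2n - 2\sqrt{2n} + 1 .$$ Moreover, for every $n \ge 1$, $$d(n) \;\ge\; 2n - \sqrt{70}\,\sqrt{n}.$$ -/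

import Mathlib

namespace RotationDistance

/-- Finite, rooted, ordered binary trees (every inner node has a left and a right subtree).
`BinaryTree.nil` is the one-vertex tree, `BinaryTree.node () l r` is the tree with left subtree `l`
and right subtree `r`, and the size of a tree (its number of inner nodes) is `numNodes`. -/
abbrev SizedTree (n : ℕ) : Type := {t : BinaryTree Unit // t.numNodes = n}

/-- `PosRotation t t'`: the tree `t'` is obtained from `t` by replacing the subtree at some inner
node, of the form `a (b c)`, with `(a b) c`. -/
inductive PosRotation : BinaryTree Unit → BinaryTree Unit → Prop
  | root (a b c : BinaryTree Unit) :
      PosRotation (.node () a (.node () b c)) (.node () (.node () a b) c)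
  | left {l l' : BinaryTree Unit} (r : BinaryTree Unit) (h : PosRotation l l') :
      PosRotation (.node () l r) (.node () l' r)
  | right (l : BinaryTree Unit) {r r' : BinaryTree Unit} (h : PosRotation r r') :
      PosRotation (.node () l r) (.node () l r')

/-- Rotations preserve the size. -/
theorem PosRotation.numNodes_eq {t t' : BinaryTree Unit} (h : PosRotation t t') :
    t.numNodes = t'.numNodes := by
  induction h with
  | root a b c => simp only [BinaryTree.numNodes]; omega
  | left r h ih => simp only [BinaryTree.numNodes]; omega
  | right l h ih => simp only [BinaryTree.numNodes]; omega

/-- A rotation always changes the tree. -/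
theorem PosRotation.irrefl (t : BinaryTree Unit) : ¬ PosRotation t t := by
  induction t with
  | nil => intro h; cases h
  | node v l r ihl ihr =>
    intro h
    generalize hs : BinaryTree.node v l r = s at h
    have key : ∀ u u' : BinaryTree Unit, PosRotation u u' → u = BinaryTree.node v l r →
        u' = BinaryTree.node v l r → False := by
      intro u u' h h1 h2
      cases h with
      | root a b c =>
        injection h1 with _ h3 h4
        injection h2 with _ h5 h6
        have := congrArg BinaryTree.numNodes (h3.trans h5.symm)
        simp only [BinaryTree.numNodes] at this
        omega
      | left r' h =>
        injection h1 with _ h3 h4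
        injection h2 with _ h5 h6
        subst h3
        subst h5
        exact ihl h
      | right l' h =>
        injection h1 with _ h3 h4
        injection h2 with _ h5 h6
        subst h4
        subst h6
        exact ihr h
    exact key s s h hs.symm hs.symm

/-- The `n`-th associahedron: the graph whose vertices are the trees of size `n`, two trees being
adjacent if one is obtained from the other by one rotation (positive or negative). -/
def associahedron (n : ℕ) : SimpleGraph (SizedTree n) where
  Adj s t := PosRotation s.1 t.1 ∨ PosRotation t.1 s.1
  symm := ⟨fun _ _ h => h.symm⟩
  loopless := ⟨fun t h => h.elim (PosRotation.irrefl t.1) (PosRotation.irrefl t.1)⟩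

/-- The rotation distance between two trees of size `n`: the least number of rotations that
transform one into the other. -/
noncomputable def rotationDist {n : ℕ} (s t : SizedTree n) : ℕ := (associahedron n).dist s t

/-- The maximal rotation distance between two trees of size `n`, which is the diameter of the
`n`-th associahedron. By `isGreatest_maxRotationDist` below it is a genuine maximum, and by
`associahedron_connected` all the distances are genuine. -/
noncomputable def maxRotationDist (n : ℕ) : ℕ := (associahedron n).diam

/-- The right comb of size `n`. -/
def rightComb : ℕ → BinaryTree Unit
  | 0 => .nil
  | n + 1 => .node () .nil (rightComb n)

theorem numNodes_rightComb (n : ℕ) : (rightComb n).numNodes = n := by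
  induction n with
  | zero => rfl
  | succ n ih => simp [rightComb, ih]

theorem eqvGen_left {l l' : BinaryTree Unit} (r : BinaryTree Unit)
    (h : Relation.EqvGen PosRotation l l') :
    Relation.EqvGen PosRotation (.node () l r) (.node () l' r) := by
  induction h with
  | rel _ _ h => exact .rel _ _ (.left r h)
  | refl _ => exact .refl _
  | symm _ _ _ ih => exact .symm _ _ ih
  | trans _ _ _ _ _ ih ih' => exact .trans _ _ _ ih ih'

theorem eqvGen_right (l : BinaryTree Unit) {r r' : BinaryTree Unit}
    (h : Relation.EqvGen PosRotation r r') :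
    Relation.EqvGen PosRotation (.node () l r) (.node () l r') := by
  induction h with
  | rel _ _ h => exact .rel _ _ (.right l h)
  | refl _ => exact .refl _
  | symm _ _ _ ih => exact .symm _ _ ih
  | trans _ _ _ _ _ ih ih' => exact .trans _ _ _ ih ih'

theorem eqvGen_node_rightComb (i j : ℕ) :
    Relation.EqvGen PosRotation (.node () (rightComb i) (rightComb j)) (rightComb (i + j + 1)) := by
  induction i with
  | zero => rw [Nat.zero_add]; exact .refl _
  | succ i ih =>
    have h := eqvGen_right .nil ih
    rw [show i + 1 + j + 1 = (i + j + 1) + 1 by omega]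
    exact .trans _ _ _ (.symm _ _ (.rel _ _ (.root .nil (rightComb i) (rightComb j)))) h

theorem eqvGen_rightComb (t : BinaryTree Unit) :
    Relation.EqvGen PosRotation t (rightComb t.numNodes) := by
  induction t with
  | nil => exact .refl _
  | node v l r ihl ihr =>
    exact .trans _ _ _ (.trans _ _ _ (eqvGen_left r ihl) (eqvGen_right _ ihr))
      (eqvGen_node_rightComb _ _)

theorem reachable_of_eqvGen {s t : BinaryTree Unit} (h : Relation.EqvGen PosRotation s t) :
    s.numNodes = t.numNodes ∧ ∀ (n : ℕ) (hs : s.numNodes = n) (ht : t.numNodes = n),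
      (associahedron n).Reachable ⟨s, hs⟩ ⟨t, ht⟩ := by
  induction h with
  | rel _ _ h => exact ⟨h.numNodes_eq, fun _ _ _ => SimpleGraph.Adj.reachable (Or.inl h)⟩
  | refl _ => exact ⟨rfl, fun _ _ _ => SimpleGraph.Reachable.refl _⟩
  | symm _ _ _ ih => exact ⟨ih.1.symm, fun n hs ht => (ih.2 n ht hs).symm⟩
  | trans _ _ _ _ _ ih ih' =>
    exact ⟨ih.1.trans ih'.1, fun n hs ht =>
      (ih.2 n hs (ih.1.symm.trans hs)).trans (ih'.2 n (ih.1.symm.trans hs) ht)⟩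

/-- Any two trees of the same size are connected by finitely many rotations. -/
theorem associahedron_connected (n : ℕ) : (associahedron n).Connected := by
  haveI : Nonempty (SizedTree n) := ⟨⟨rightComb n, numNodes_rightComb n⟩⟩
  refine ⟨fun s t => ?_⟩
  have h : Relation.EqvGen PosRotation s.1 t.1 := by
    have h1 := eqvGen_rightComb s.1
    have h2 := eqvGen_rightComb t.1
    rw [s.2] at h1
    rw [t.2] at h2
    exact .trans _ _ _ h1 (.symm _ _ h2)
  exact (reachable_of_eqvGen h).2 n s.2 t.2

instance finite_sizedTree (n : ℕ) : Finite (SizedTree n) :=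
  Finite.of_injective
    (fun t : SizedTree n =>
      (⟨t.1, BinaryTree.mem_treesOfNumNodesEq.mpr t.2⟩ : BinaryTree.treesOfNumNodesEq n))
    (fun s t h => Subtype.ext (congrArg (fun x => x.1) h))

/-- `maxRotationDist n` is the maximum of the rotation distances between trees of size `n`. -/
theorem isGreatest_maxRotationDist (n : ℕ) :
    IsGreatest {k : ℕ | ∃ s t : SizedTree n, rotationDist s t = k} (maxRotationDist n) := by
  haveI : Nonempty (SizedTree n) := ⟨⟨rightComb n, numNodes_rightComb n⟩⟩
  refine ⟨SimpleGraph.exists_dist_eq_diam, ?_⟩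
  rintro k ⟨s, t, rfl⟩
  exact SimpleGraph.dist_le_diam
    (SimpleGraph.connected_iff_ediam_ne_top.mp (associahedron_connected n))

end RotationDistance

/-! A tree of size n is dual to a triangulation of a polygon with n + 2 vertices, and a rotation is
a flip of a diagonal. Give the vertices levels that rise and then fall along 0, ..., n + 1. A
triangle with a unique vertex of largest level is recorded as that vertex, its apex, in the multiset
indexed by its second largest level k. The weight of this multiset is its cardinality plus the
number of its distinct elements other than a chosen vertex y(k).

A flip affects only the multiset whose index is the second smallest level of the quadrilateral, and
there it either exchanges one apex for another or turns {u, u} into {u}, or conversely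
(`Unimodal.close_apexes`). In the first case only the number of distinct elements can change, in the
second only the cardinality, by at most 1 each time. Hence the sum over k of the weight differences
is a lower bound for the distance (`sum_abs_weight_le_rotationDist`).

For n = 2mp, take blocks of p vertices with odd levels on the left and even levels on the right. Two
zigzags, shifted against each other by one block, play opposite roles: for every level 0 < k < 2m
one of them has p distinct apexes, hence weight at least 2p, and the other has a single one.
Choosing that one as y(k) makes its weight 1, not 2. So the distance is at least (2m - 1)(2p - 1)
(`mul_le_maxRotationDist`), and it remains to choose m and p. -/

namespace RotationDistance

/-! ### Triangulations and flips -/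

/-- The triangles of the triangulation dual to `t`, when the leaves of `t` are the edges
`(a, a + 1), (a + 1, a + 2), …` of a polygon. -/
def triangles : BinaryTree Unit → ℕ → Multiset (ℕ × ℕ × ℕ)
  | .nil, _ => 0
  | .node _ l r, a => (a, a + l.numNodes + 1, a + l.numNodes + r.numNodes + 2) ::ₘ
      (triangles l a + triangles r (a + l.numNodes + 1))

/-- A rotation exchanges the two triangles of one diagonal of a quadrilateral with those of the
other. -/
theorem PosRotation.exists_triangles {t t' : BinaryTree Unit} (h : PosRotation t t') (a : ℕ) :
    ∃ (R : Multiset (ℕ × ℕ × ℕ)) (w x y z : ℕ), w < x ∧ x < y ∧ y < z ∧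
      triangles t a = R + {(w, x, z), (x, y, z)} ∧
      triangles t' a = R + {(w, x, y), (w, y, z)} := by
  induction h generalizing a with
  | root A B C =>
    refine ⟨triangles A a + triangles B (a + A.numNodes + 1) +
      triangles C (a + A.numNodes + 1 + B.numNodes + 1), a, a + A.numNodes + 1,
      a + A.numNodes + 1 + B.numNodes + 1, a + A.numNodes + 1 + B.numNodes + C.numNodes + 2,
      by omega, by omega, by omega, ?_, ?_⟩
    · simp only [triangles, BinaryTree.numNodes, Multiset.insert_eq_cons,
        ← Multiset.singleton_add]
      have : a + A.numNodes + (B.numNodes + C.numNodes + 1) + 2 =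
        a + A.numNodes + 1 + B.numNodes + C.numNodes + 2 := by omega
      rw [this]
      abel
    · simp only [triangles, BinaryTree.numNodes, Multiset.insert_eq_cons,
        ← Multiset.singleton_add]
      have h1 : a + (A.numNodes + B.numNodes + 1) + 1 = a + A.numNodes + 1 + B.numNodes + 1 := by
        omega
      have h2 : a + (A.numNodes + B.numNodes + 1) + C.numNodes + 2 =
        a + A.numNodes + 1 + B.numNodes + C.numNodes + 2 := by omega
      have h3 : a + A.numNodes + B.numNodes + 2 = a + A.numNodes + 1 + B.numNodes + 1 := by omega
      rw [h1, h2, h3]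
      abel
  | @left l l' r h ih =>
    obtain ⟨R, w, x, y, z, h1, h2, h3, h4, h5⟩ := ih a
    refine ⟨(a, a + l.numNodes + 1, a + l.numNodes + r.numNodes + 2) ::ₘ
      (R + triangles r (a + l.numNodes + 1)), w, x, y, z, h1, h2, h3, ?_, ?_⟩
    · simp only [triangles, h4, ← Multiset.singleton_add]
      abel
    · simp only [triangles, h5, ← h.numNodes_eq, ← Multiset.singleton_add]
      abel
  | @right l r r' h ih =>
    obtain ⟨R, w, x, y, z, h1, h2, h3, h4, h5⟩ := ih (a + l.numNodes + 1)
    refine ⟨(a, a + l.numNodes + 1, a + l.numNodes + r.numNodes + 2) ::ₘ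
      (R + triangles l a), w, x, y, z, h1, h2, h3, ?_, ?_⟩
    · simp only [triangles, h4, ← Multiset.singleton_add]
      abel
    · simp only [triangles, h5, ← h.numNodes_eq, ← Multiset.singleton_add]
      abel

theorem mem_triangles {t : BinaryTree Unit} {a : ℕ} {τ : ℕ × ℕ × ℕ} (h : τ ∈ triangles t a) :
    a ≤ τ.1 ∧ τ.1 ≤ τ.2.1 ∧ τ.2.1 ≤ τ.2.2 ∧ τ.2.2 ≤ a + t.numNodes + 1 := by
  induction t generalizing a with
  | nil => simp [triangles] at h
  | node _ l r ihl ihr =>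
    simp only [triangles, Multiset.mem_cons, Multiset.mem_add, BinaryTree.numNodes] at h ⊢
    rcases h with rfl | h | h
    · dsimp only
      omega
    · have := ihl h
      omega
    · have := ihr h
      omega

/-! ### Apexes, weights and their change under a flip -/

/-- If the largest but one of the levels `ℓ` of the vertices of the triangle `τ` is `k`, and the
largest level is greater than `k`, then this is the vertex of largest level. -/
def apexes (ℓ : ℕ → ℕ) (k : ℕ) (τ : ℕ × ℕ × ℕ) : Multiset ℕ :=
  (if max (ℓ τ.1) (ℓ τ.2.1) = k ∧ k < ℓ τ.2.2 then {τ.2.2} else 0) +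
  (if max (ℓ τ.1) (ℓ τ.2.2) = k ∧ k < ℓ τ.2.1 then {τ.2.1} else 0) +
  (if max (ℓ τ.2.1) (ℓ τ.2.2) = k ∧ k < ℓ τ.1 then {τ.1} else 0)

theorem apexes_eq_zero_of_le {ℓ : ℕ → ℕ} {k : ℕ} {τ : ℕ × ℕ × ℕ} (h1 : ℓ τ.1 ≤ k)
    (h2 : ℓ τ.2.1 ≤ k) (h3 : ℓ τ.2.2 ≤ k) : apexes ℓ k τ = 0 := by
  unfold apexes
  rw [if_neg (by omega), if_neg (by omega), if_neg (by omega)]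
  rfl

theorem apexes_eq_zero_of_lt {ℓ : ℕ → ℕ} {k : ℕ} {τ : ℕ × ℕ × ℕ} (h1 : k < ℓ τ.1)
    (h2 : k < ℓ τ.2.1) (h3 : k < ℓ τ.2.2) : apexes ℓ k τ = 0 := by
  unfold apexes
  rw [if_neg (by omega), if_neg (by omega), if_neg (by omega)]
  rfl

/-- Two multisets are close if they are equal, or they both have one element, or one of them is
`{u, u}` and the other one is `{u}`. -/
def Close (M M' : Multiset ℕ) : Prop :=
  M = M' ∨ (∃ u v, M = {u} ∧ M' = {v}) ∨ (∃ u, M = {u, u} ∧ M' = {u}) ∨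
    ∃ u, M = {u} ∧ M' = {u, u}

theorem Close.symm {M M' : Multiset ℕ} (h : Close M M') : Close M' M := by
  rcases h with h | ⟨u, v, h, h'⟩ | ⟨u, h, h'⟩ | ⟨u, h, h'⟩
  · exact .inl h.symm
  · exact .inr (.inl ⟨v, u, h', h⟩)
  · exact .inr (.inr (.inr ⟨u, h', h⟩))
  · exact .inr (.inr (.inl ⟨u, h', h⟩))

/-- The number of elements, plus the number of distinct elements other than `y`. -/
def weight (y : ℕ) (C : Multiset ℕ) : ℕ := C.card + (C.toFinset.erase y).card

theorem Close.weight_le {M M' : Multiset ℕ} (h : Close M M') (y : ℕ) (C : Multiset ℕ) :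
    weight y (C + M) ≤ weight y (C + M') + 1 := by
  unfold weight
  rcases h with rfl | ⟨u, v, rfl, rfl⟩ | ⟨u, rfl, rfl⟩ | ⟨u, rfl, rfl⟩
  · omega
  · have h1 : ((C + {u}).toFinset.erase y).card ≤ (C.toFinset.erase y).card + 1 := by
      refine (Finset.card_le_card (t := insert u (C.toFinset.erase y)) ?_).trans
        (Finset.card_insert_le _ _)
      intro x
      simp
      tauto
    have h2 : (C.toFinset.erase y).card ≤ ((C + {v}).toFinset.erase y).card := by
      refine Finset.card_le_card (Finset.erase_subset_erase _ ?_)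
      intro x
      simp
      tauto
    simp only [Multiset.card_add, Multiset.card_singleton]
    omega
  · have h : (C + {u, u}).toFinset = (C + {u}).toFinset := by
      ext x
      simp
    rw [h]
    simp
    omega
  · have h : (C + {u, u}).toFinset = (C + {u}).toFinset := by
      ext x
      simp
    rw [h]
    simp
    omega

/-- Every superlevel set of `ℓ` is convex. -/
def Unimodal (ℓ : ℕ → ℕ) : Prop := ∀ a b c, a < b → b < c → min (ℓ a) (ℓ c) ≤ ℓ b

/-- The number of elements of the quadruple whose level satisfies `P`. -/
def countLevels (P : ℕ → Prop) [DecidablePred P] (p q r s : ℕ) : ℕ :=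
  (if P p then 1 else 0) + (if P q then 1 else 0) + (if P r then 1 else 0) + (if P s then 1 else 0)

-- A triangle counts for k if exactly one vertex lies above k and the other two have maximum k, so
-- only the comparisons of the four levels with k matter. The last two conjuncts say that k is the
-- second smallest of the four levels. Unimodality excludes, for instance, two opposite vertices
-- above k separated by lower ones, where two apexes would vanish at once.
set_option maxHeartbeats 1000000 in
theorem Unimodal.close_apexes {ℓ : ℕ → ℕ} (hℓ : Unimodal ℓ) {w x y z : ℕ} (hwx : w < x)
    (hxy : x < y) (hyz : y < z) (k : ℕ) :
    apexes ℓ k (w, x, z) + apexes ℓ k (x, y, z) = apexes ℓ k (w, x, y) + apexes ℓ k (w, y, z) ∨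
    (Close (apexes ℓ k (w, x, z) + apexes ℓ k (x, y, z))
      (apexes ℓ k (w, x, y) + apexes ℓ k (w, y, z)) ∧
      countLevels (· < k) (ℓ w) (ℓ x) (ℓ y) (ℓ z) ≤ 1 ∧
      2 ≤ countLevels (· ≤ k) (ℓ w) (ℓ x) (ℓ y) (ℓ z)) := by
  have h1 := hℓ w x y hwx hxy
  have h2 := hℓ x y z hxy hyz
  have h3 := hℓ w x z hwx (hxy.trans hyz)
  have h4 := hℓ w y z (hwx.trans hxy) hyz
  unfold apexes countLevels Close
  dsimp only
  generalize ℓ w = p at *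
  generalize ℓ x = q at *
  generalize ℓ y = r at *
  generalize ℓ z = s at *
  rcases lt_trichotomy p k with hp | hp | hp <;> rcases lt_trichotomy q k with hq | hq | hq <;>
  rcases lt_trichotomy r k with hr | hr | hr <;> rcases lt_trichotomy s k with hs | hs | hs <;>
  first
  | (exfalso; omega)
  | (simp (disch := omega) only [if_pos, if_neg]
     simp)

/-- The apexes of level `k` of all the triangles of `t`, with a multiplicity. -/
def treeApexes (ℓ : ℕ → ℕ) (k : ℕ) (t : BinaryTree Unit) (a : ℕ) : Multiset ℕ :=
  ((triangles t a).map (apexes ℓ k)).sum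

theorem PosRotation.exists_weight_le {ℓ : ℕ → ℕ} (hℓ : Unimodal ℓ) (y : ℕ → ℕ)
    {t t' : BinaryTree Unit} (h : PosRotation t t') :
    ∃ k₀, ∀ k,
      |(weight (y k) (treeApexes ℓ k t 0) : ℤ) - weight (y k) (treeApexes ℓ k t' 0)| ≤
        if k = k₀ then 1 else 0 := by
  obtain ⟨R, w, x, y', z, hwx, hxy, hyz, ht, ht'⟩ := h.exists_triangles 0
  have key := hℓ.close_apexes hwx hxy hyz
  have e : ∀ k, treeApexes ℓ k t 0 =
      (R.map (apexes ℓ k)).sum + (apexes ℓ k (w, x, z) + apexes ℓ k (x, y', z)) := by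
    intro k
    simp [treeApexes, ht, add_left_comm]
  have e' : ∀ k, treeApexes ℓ k t' 0 =
      (R.map (apexes ℓ k)).sum + (apexes ℓ k (w, x, y') + apexes ℓ k (w, y', z)) := by
    intro k
    simp [treeApexes, ht', add_left_comm]
  by_cases hk : ∃ k₀, apexes ℓ k₀ (w, x, z) + apexes ℓ k₀ (x, y', z) ≠
      apexes ℓ k₀ (w, x, y') + apexes ℓ k₀ (w, y', z)
  · obtain ⟨k₀, hk₀⟩ := hk
    obtain ⟨hc, hlt, hle⟩ := (key k₀).resolve_left hk₀
    refine ⟨k₀, fun k => ?_⟩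
    rw [e, e']
    split_ifs with hkk
    · subst hkk
      have h1 := hc.weight_le (y k) (R.map (apexes ℓ k)).sum
      have h2 := hc.symm.weight_le (y k) (R.map (apexes ℓ k)).sum
      rw [abs_le]
      constructor <;> linarith
    · rcases key k with h | ⟨-, hlt', hle'⟩
      · rw [h]
        simp
      · exfalso
        unfold countLevels at *
        beta_reduce at *
        rcases lt_or_gt_of_ne hkk with hkk | hkk
        · have mono : ∀ v, (if v ≤ k then 1 else 0) ≤ if v < k₀ then 1 else 0 := by
            intro v
            split_ifs <;> omega
          have := mono (ℓ w)
          have := mono (ℓ x)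
          have := mono (ℓ y')
          have := mono (ℓ z)
          omega
        · have mono : ∀ v, (if v ≤ k₀ then 1 else 0) ≤ if v < k then 1 else 0 := by
            intro v
            split_ifs <;> omega
          have := mono (ℓ w)
          have := mono (ℓ x)
          have := mono (ℓ y')
          have := mono (ℓ z)
          omega
  · push Not at hk
    refine ⟨0, fun k => ?_⟩
    rw [e, e', hk k, sub_self, abs_zero]
    split_ifs <;> norm_num

theorem sum_abs_weight_le_one {ℓ : ℕ → ℕ} (hℓ : Unimodal ℓ) (y : ℕ → ℕ) (K : Finset ℕ)
    {n : ℕ} {s t : SizedTree n} (h : (associahedron n).Adj s t) :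
    ∑ k ∈ K, |(weight (y k) (treeApexes ℓ k s.1 0) : ℤ) - weight (y k) (treeApexes ℓ k t.1 0)| ≤
      1 := by
  have h1 : ∃ k₀, ∀ k, |(weight (y k) (treeApexes ℓ k s.1 0) : ℤ) -
      weight (y k) (treeApexes ℓ k t.1 0)| ≤ if k = k₀ then 1 else 0 := by
    rcases h with h | h
    · exact h.exists_weight_le hℓ y
    · obtain ⟨k₀, hk₀⟩ := h.exists_weight_le hℓ y
      exact ⟨k₀, fun k => by rw [abs_sub_comm]; exact hk₀ k⟩
  obtain ⟨k₀, hk₀⟩ := h1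
  refine (Finset.sum_le_sum fun k _ => hk₀ k).trans ?_
  rw [Finset.sum_ite_eq']
  split_ifs <;> norm_num

/-- A lower bound for the rotation distance. -/
theorem sum_abs_weight_le_rotationDist {ℓ : ℕ → ℕ} (hℓ : Unimodal ℓ) (y : ℕ → ℕ) (K : Finset ℕ)
    {n : ℕ} (s t : SizedTree n) :
    ∑ k ∈ K, |(weight (y k) (treeApexes ℓ k s.1 0) : ℤ) - weight (y k) (treeApexes ℓ k t.1 0)| ≤
      rotationDist s t := by
  obtain ⟨w, hw⟩ := (associahedron_connected n).exists_walk_length_eq_dist s t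
  rw [rotationDist, ← hw]
  clear hw
  induction w with
  | nil => simp
  | @cons u v r h w ih =>
    have h1 := sum_abs_weight_le_one hℓ y K h
    rw [SimpleGraph.Walk.length_cons]
    push_cast
    calc _ ≤ ∑ k ∈ K, (|(weight (y k) (treeApexes ℓ k u.1 0) : ℤ) -
            weight (y k) (treeApexes ℓ k v.1 0)| + |(weight (y k) (treeApexes ℓ k v.1 0) : ℤ) -
            weight (y k) (treeApexes ℓ k r.1 0)|) :=
          Finset.sum_le_sum fun k _ => abs_sub_le _ _ _
      _ ≤ _ := by
        rw [Finset.sum_add_distrib]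
        linarith

theorem rotationDist_le_maxRotationDist {n : ℕ} (s t : SizedTree n) :
    rotationDist s t ≤ maxRotationDist n :=
  (isGreatest_maxRotationDist n).2 ⟨s, t, rfl⟩

theorem weight_singleton (y : ℕ) : weight y {y} = 1 := by
  simp [weight]

/-- Each of the p values counts twice: once in the cardinality and once as a distinct element. -/
theorem two_mul_le_weight {y p : ℕ} {C : Multiset ℕ} {f : ℕ → ℕ}
    (hinj : Set.InjOn f (Finset.range p)) (hf : ∀ s < p, f s ∈ C ∧ f s ≠ y) :
    2 * p ≤ weight y C := by
  have h1 : p ≤ (C.toFinset.erase y).card := by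
    calc p = ((Finset.range p).image f).card := by
          rw [Finset.card_image_of_injOn hinj, Finset.card_range]
      _ ≤ _ := Finset.card_le_card fun x hx => by
          obtain ⟨s, hs, rfl⟩ := Finset.mem_image.mp hx
          have := hf s (Finset.mem_range.mp hs)
          simp [this.1, this.2]
  have h2 : (C.toFinset.erase y).card ≤ C.card :=
    (Finset.card_le_card (Finset.erase_subset _ _)).trans (Multiset.toFinset_card_le C)
  unfold weight
  omega

/-! ### Apexes of the building blocks -/

theorem treeApexes_node (ℓ : ℕ → ℕ) (k : ℕ) (v : Unit) (l r : BinaryTree Unit) (a : ℕ) :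
    treeApexes ℓ k (.node v l r) a =
      apexes ℓ k (a, a + l.numNodes + 1, a + l.numNodes + r.numNodes + 2) +
        treeApexes ℓ k l a + treeApexes ℓ k r (a + l.numNodes + 1) := by
  simp [treeApexes, triangles, add_assoc]

theorem treeApexes_nil (ℓ : ℕ → ℕ) (k a : ℕ) : treeApexes ℓ k .nil a = 0 := by
  simp [treeApexes, triangles]

theorem treeApexes_eq_zero {ℓ : ℕ → ℕ} {k : ℕ} {t : BinaryTree Unit} {a : ℕ}
    (h : (∀ v, a ≤ v → v ≤ a + t.numNodes + 1 → ℓ v ≤ k) ∨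
      ∀ v, a ≤ v → v ≤ a + t.numNodes + 1 → k < ℓ v) : treeApexes ℓ k t a = 0 := by
  refine Multiset.sum_eq_zero fun M hM => ?_
  obtain ⟨τ, hτ, rfl⟩ := Multiset.mem_map.mp hM
  obtain ⟨h1, h2, h3, h4⟩ := mem_triangles hτ
  rcases h with h | h
  · exact apexes_eq_zero_of_le (h _ (by omega) (by omega)) (h _ (by omega) (by omega))
      (h _ (by omega) (by omega))
  · exact apexes_eq_zero_of_lt (h _ (by omega) (by omega)) (h _ (by omega) (by omega))
      (h _ (by omega) (by omega))

/-- The zigzag with `2 * q` inner nodes on top of the tree `B`. -/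
def zigzag (B : BinaryTree Unit) : ℕ → BinaryTree Unit
  | 0 => B
  | q + 1 => .node () .nil (.node () (zigzag B q) .nil)

theorem numNodes_zigzag (B : BinaryTree Unit) (q : ℕ) :
    (zigzag B q).numNodes = B.numNodes + 2 * q := by
  induction q with
  | zero => rfl
  | succ q ih =>
    simp only [zigzag, BinaryTree.numNodes, ih]
    omega

theorem treeApexes_zigzag (ℓ : ℕ → ℕ) (k : ℕ) (B : BinaryTree Unit) (q a : ℕ) :
    treeApexes ℓ k (zigzag B q) a = ∑ i ∈ Finset.range q,
      (apexes ℓ k (a + i, a + i + 1, a + B.numNodes + 2 * q + 1 - i) +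
        apexes ℓ k (a + i + 1, a + B.numNodes + 2 * q - i, a + B.numNodes + 2 * q + 1 - i)) +
      treeApexes ℓ k B (a + q) := by
  induction q generalizing a with
  | zero => simp [zigzag]
  | succ q ih =>
    rw [Finset.sum_range_succ', zigzag, treeApexes_node, treeApexes_node, treeApexes_nil,
      treeApexes_nil, ih]
    simp only [BinaryTree.numNodes, numNodes_zigzag]
    have h : ∀ i, (apexes ℓ k (a + 0 + 1 + i, a + 0 + 1 + i + 1,
          a + 0 + 1 + B.numNodes + 2 * q + 1 - i) +
        apexes ℓ k (a + 0 + 1 + i + 1, a + 0 + 1 + B.numNodes + 2 * q - i,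
          a + 0 + 1 + B.numNodes + 2 * q + 1 - i)) =
        (apexes ℓ k (a + (i + 1), a + (i + 1) + 1,
          a + B.numNodes + 2 * (q + 1) + 1 - (i + 1)) +
        apexes ℓ k (a + (i + 1) + 1, a + B.numNodes + 2 * (q + 1) - (i + 1),
          a + B.numNodes + 2 * (q + 1) + 1 - (i + 1))) := by
      intro i
      have f1 : a + 0 + 1 + i = a + (i + 1) := by omega
      have f2 : a + 0 + 1 + B.numNodes + 2 * q + 1 - i =
        a + B.numNodes + 2 * (q + 1) + 1 - (i + 1) := by omega
      have f3 : a + 0 + 1 + B.numNodes + 2 * q - i = a + B.numNodes + 2 * (q + 1) - (i + 1) := by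
        omega
      rw [f1, f2, f3]
    rw [Finset.sum_congr rfl fun i _ => h i]
    have e1 : a + 0 + (B.numNodes + 2 * q + 0 + 1) + 2 = a + B.numNodes + 2 * (q + 1) + 1 - 0 := by
      omega
    have e2 : a + 0 + 1 + (B.numNodes + 2 * q) + 1 = a + B.numNodes + 2 * (q + 1) - 0 := by omega
    have e3 : a + 0 + 1 + (B.numNodes + 2 * q) + 0 + 2 = a + B.numNodes + 2 * (q + 1) + 1 - 0 := by
      omega
    have e4 : a + 0 + 1 + q = a + (q + 1) := by omega
    rw [e1, e2, e3, e4]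
    simp only [add_zero]
    abel

/-- The tree `t` on top of which the left comb of size `r` is added. -/
def pad (t : BinaryTree Unit) : ℕ → BinaryTree Unit
  | 0 => t
  | r + 1 => .node () (pad t r) .nil

theorem numNodes_pad (t : BinaryTree Unit) (r : ℕ) : (pad t r).numNodes = t.numNodes + r := by
  induction r with
  | zero => rfl
  | succ r ih =>
    simp only [pad, BinaryTree.numNodes, ih]
    omega

/-- Each added triangle has two vertices of level 0, so it can only contribute to k = 0. This
extends the construction to sizes that are not of the form 2mp. -/
theorem treeApexes_pad {ℓ : ℕ → ℕ} {k : ℕ} (hk : 0 < k) {t : BinaryTree Unit} (h0 : ℓ 0 = 0)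
    (h : ∀ v, t.numNodes + 1 < v → ℓ v = 0) (r : ℕ) :
    treeApexes ℓ k (pad t r) 0 = treeApexes ℓ k t 0 := by
  induction r with
  | zero => rfl
  | succ r ih =>
    rw [pad, treeApexes_node, ih, treeApexes_nil]
    have h1 : ℓ (0 + (pad t r).numNodes + (BinaryTree.nil : BinaryTree Unit).numNodes + 2) = 0 := by
      apply h
      simp only [numNodes_pad, BinaryTree.numNodes]
      omega
    have : apexes ℓ k (0, 0 + (pad t r).numNodes + 1,
        0 + (pad t r).numNodes + (BinaryTree.nil : BinaryTree Unit).numNodes + 2) = 0 := by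
      unfold apexes
      dsimp only
      rw [h0, h1, if_neg (by omega), if_neg (by omega), if_neg (by omega)]
      rfl
    rw [this]
    simp

theorem apexes_eq_third {ℓ : ℕ → ℕ} {a b c : ℕ} (k : ℕ) (h : max (ℓ a) (ℓ b) < ℓ c) :
    apexes ℓ k (a, b, c) = if max (ℓ a) (ℓ b) = k then {c} else 0 := by
  unfold apexes
  dsimp only
  rw [if_neg (c := max (ℓ a) (ℓ c) = k ∧ _) (by omega),
    if_neg (c := max (ℓ b) (ℓ c) = k ∧ _) (by omega), add_zero, add_zero]
  exact if_congr (by omega) rfl rfl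

theorem apexes_eq_second {ℓ : ℕ → ℕ} {a b c : ℕ} (k : ℕ) (h : max (ℓ a) (ℓ c) < ℓ b) :
    apexes ℓ k (a, b, c) = if max (ℓ a) (ℓ c) = k then {b} else 0 := by
  unfold apexes
  dsimp only
  rw [if_neg (c := max (ℓ a) (ℓ b) = k ∧ _) (by omega),
    if_neg (c := max (ℓ b) (ℓ c) = k ∧ _) (by omega), add_zero, zero_add]
  exact if_congr (by omega) rfl rfl

theorem apexes_eq_first {ℓ : ℕ → ℕ} {a b c : ℕ} (k : ℕ) (h : max (ℓ b) (ℓ c) < ℓ a) :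
    apexes ℓ k (a, b, c) = if max (ℓ b) (ℓ c) = k then {a} else 0 := by
  unfold apexes
  dsimp only
  rw [if_neg (c := max (ℓ a) (ℓ b) = k ∧ _) (by omega),
    if_neg (c := max (ℓ a) (ℓ c) = k ∧ _) (by omega), zero_add, zero_add]
  exact if_congr (by omega) rfl rfl

/-- The two largest levels coincide, so no vertex lies strictly above the second largest level. -/
theorem apexes_eq_zero_of_tie {ℓ : ℕ → ℕ} {a b c : ℕ} (k : ℕ)
    (h : ℓ a ≤ ℓ b ∧ ℓ c = ℓ b ∨ ℓ c ≤ ℓ a ∧ ℓ a = ℓ b) : apexes ℓ k (a, b, c) = 0 := by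
  unfold apexes
  dsimp only
  rw [if_neg (by omega), if_neg (by omega), if_neg (by omega)]
  rfl

/-! ### The levels -/

/-- The levels of the vertices of a polygon with `2 * N + 2` vertices: the levels are constant on
blocks of `p` vertices and increase alternately on the left and on the right side, from the
vertex `0` to the vertex `N + 1`. -/
def level (p N v : ℕ) : ℕ :=
  if v = 0 then 0 else if v ≤ N + 1 then 2 * ((v - 1) / p) + 1
    else if v ≤ 2 * N + 1 then 2 * ((2 * N + 1 - v) / p) + 2 else 0

theorem level_zero (p N : ℕ) : level p N 0 = 0 := by simp [level]

theorem level_left {p N i : ℕ} (h : i ≤ N) : level p N (i + 1) = 2 * (i / p) + 1 := by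
  rw [level, if_neg (by omega), if_pos (by omega), Nat.add_sub_cancel]

theorem level_right {p N v t : ℕ} (h : t < N) (hv : v = 2 * N + 1 - t) :
    level p N v = 2 * (t / p) + 2 := by
  subst hv
  rw [level, if_neg (by omega), if_neg (by omega), if_pos (by omega)]
  congr 3
  omega

theorem level_of_lt {p N v : ℕ} (h : 2 * N + 1 < v) : level p N v = 0 := by
  rw [level, if_neg (by omega), if_neg (by omega), if_neg (by omega)]

theorem unimodal_level (p N : ℕ) : Unimodal (level p N) := by
  intro a b c hab hbc
  rcases Nat.lt_or_ge (2 * N + 1) b with h | h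
  · rw [level_of_lt (h.trans hbc)]
    omega
  · rcases Nat.lt_or_ge (N + 1) b with h' | h'
    · refine (min_le_right _ _).trans ?_
      rcases Nat.lt_or_ge (2 * N + 1) c with hc | hc
      · rw [level_of_lt hc]
        omega
      · rw [level_right (v := b) (t := 2 * N + 1 - b) (by omega) (by omega),
          level_right (v := c) (t := 2 * N + 1 - c) (by omega) (by omega)]
        have := Nat.div_le_div_right (c := p) (show 2 * N + 1 - c ≤ 2 * N + 1 - b by omega)
        omega
    · refine (min_le_left _ _).trans ?_
      rcases Nat.eq_zero_or_pos a with rfl | ha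
      · rw [level_zero]
        omega
      · obtain ⟨i, rfl⟩ : ∃ i, a = i + 1 := ⟨a - 1, by omega⟩
        obtain ⟨j, rfl⟩ : ∃ j, b = j + 1 := ⟨b - 1, by omega⟩
        rw [level_left (by omega), level_left (by omega)]
        have := Nat.div_le_div_right (c := p) (show i ≤ j by omega)
        omega

/-- The last index of block c; this is where the zigzags record their single apex. -/
theorem div_eq_and_dvd_iff {p i c : ℕ} (hp : 0 < p) :
    (c = i / p ∧ p ∣ i + 1) ↔ i = (c + 1) * p - 1 := by
  constructor
  · rintro ⟨rfl, h⟩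
    have h1 : (i + 1) / p = i / p + 1 := by rw [Nat.succ_div, if_pos h]
    have h2 := Nat.div_mul_cancel h
    rw [h1] at h2
    omega
  · intro h
    have h1 : i + 1 = (c + 1) * p := by
      have : 0 < (c + 1) * p := by positivity
      omega
    have h2 : p ∣ i + 1 := ⟨c + 1, by rw [h1, mul_comm]⟩
    have h3 : (i + 1) / p = i / p + 1 := by rw [Nat.succ_div, if_pos h2]
    rw [h1, Nat.mul_div_cancel _ hp] at h3
    exact ⟨by omega, h2⟩

theorem succ_div_eq_or (p i : ℕ) :
    p ∣ i + 1 ∧ (i + 1) / p = i / p + 1 ∨ ¬ p ∣ i + 1 ∧ (i + 1) / p = i / p := by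
  rw [Nat.succ_div]
  by_cases h : p ∣ i + 1 <;> simp [h]

/-! ### The two trees and their apexes -/

/-- The first tree of a pair of trees at large distance. -/
def firstTree (N : ℕ) : BinaryTree Unit := zigzag .nil N

/-- The second tree of a pair of trees at large distance. -/
def secondTree (p N : ℕ) : BinaryTree Unit :=
  .node () (.node () (rightComb (p - 1)) .nil) (zigzag (rightComb (p - 1)) (N - p))

theorem numNodes_firstTree (N : ℕ) : (firstTree N).numNodes = 2 * N := by
  simp [firstTree, numNodes_zigzag, BinaryTree.numNodes]

theorem numNodes_secondTree {p N : ℕ} (hp : 0 < p) (hN : p ≤ N) :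
    (secondTree p N).numNodes = 2 * N := by
  simp only [secondTree, numNodes_zigzag, BinaryTree.numNodes, numNodes_rightComb]
  omega

/-- Step i of the zigzag has two triangles. The first joins a left edge to a right vertex one level
higher and always gives an apex. The second stands on a right edge and gives one only if that edge
leaves its block; otherwise its two top levels tie. -/
theorem treeApexes_firstTree {p m k : ℕ} (hp : 0 < p) (hkm : k < 2 * m) :
    treeApexes (level p (m * p)) k (firstTree (m * p)) 0 = ∑ i ∈ Finset.range (m * p),
      ((if 2 * (i / p) + 1 = k then {2 * (m * p) + 1 - i} else 0) +
        if 2 * (i / p) + 2 = k ∧ p ∣ i + 1 then {2 * (m * p) - i} else 0) := by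
  rw [firstTree, treeApexes_zigzag, treeApexes_nil, add_zero]
  refine Finset.sum_congr rfl fun i hi => ?_
  rw [Finset.mem_range] at hi
  simp only [BinaryTree.numNodes, zero_add]
  have hdiv : i / p < m := Nat.div_lt_of_lt_mul (by rwa [mul_comm])
  have l1 : level p (m * p) (i + 1) = 2 * (i / p) + 1 := level_left (by omega)
  have l2 : level p (m * p) (2 * (m * p) + 1 - i) = 2 * (i / p) + 2 := level_right hi rfl
  have l0 : level p (m * p) i ≤ 2 * (i / p) + 1 := by
    rcases Nat.eq_zero_or_pos i with rfl | h
    · rw [level_zero]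
      omega
    · obtain ⟨j, rfl⟩ : ∃ j, i = j + 1 := ⟨i - 1, by omega⟩
      rw [level_left (by omega)]
      have := Nat.div_le_div_right (c := p) (show j ≤ j + 1 by omega)
      omega
  congr 1
  · rw [apexes_eq_third k (by omega)]
    exact if_congr (by omega) rfl rfl
  · rcases Nat.lt_or_ge (i + 1) (m * p) with hi' | hi'
    · have l3 : level p (m * p) (2 * (m * p) - i) = 2 * ((i + 1) / p) + 2 :=
        level_right hi' (by omega)
      rcases succ_div_eq_or p i with ⟨h, h'⟩ | ⟨h, h'⟩
      · rw [apexes_eq_second k (by omega)]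
        refine if_congr ?_ rfl rfl
        simp only [h, and_true]
        omega
      · rw [apexes_eq_zero_of_tie k (by omega), if_neg (by simp [h])]
    -- At the last step the vertex 2N - i is N + 1, whose level belongs to the left side; the apex
    -- has index 2m and so does not count.
    · have hi'' : i + 1 = m * p := by omega
      have hd : (i + 1) / p = m := by rw [hi'', Nat.mul_div_cancel _ hp]
      have l3 : level p (m * p) (2 * (m * p) - i) = 2 * ((i + 1) / p) + 1 := by
        rw [← level_left (N := m * p) hi''.le]
        congr 1
        omega
      have h' : (i + 1) / p = i / p + 1 := by
        rcases succ_div_eq_or p i with ⟨h, h'⟩ | ⟨h, h'⟩ <;> omega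
      rw [apexes_eq_second k (by omega), if_neg (by omega), if_neg (by omega)]

/-- Starting the left side one block later puts it above the right side, which exchanges the roles
of the two kinds of triangles. The two separate terms come from (0, p + 1, 2N + 1) and (0, p, p +
1). The first comb has only levels at most 1, the second only levels above k, so neither
contributes. -/
theorem treeApexes_secondTree {p m k : ℕ} (hp : 0 < p) (hm : 0 < m) (hk : 0 < k)
    (hkm : k < 2 * m) :
    treeApexes (level p (m * p)) k (secondTree p (m * p)) 0 =
      (if k = 2 then {p + 1} else 0) + (if k = 1 then {p + 1} else 0) +
      ∑ i ∈ Finset.range (m * p - p),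
      ((if 2 * (i / p) + 3 = k ∧ p ∣ i + 1 then {p + 2 + i} else 0) +
        if 2 * ((i + 1) / p) + 2 = k then {p + 2 + i} else 0) := by
  have hpm : p ≤ m * p := Nat.le_mul_of_pos_left p hm
  have lp : level p (m * p) p = 1 := by
    obtain ⟨j, rfl⟩ : ∃ j, p = j + 1 := ⟨p - 1, by omega⟩
    rw [level_left (by omega), Nat.div_eq_of_lt (by omega)]
  have lp1 : level p (m * p) (p + 1) = 3 := by
    rw [level_left hpm, Nat.div_self hp]
  have lr : level p (m * p) (2 * (m * p) + 1) = 2 := by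
    rw [level_right (t := 0) (by omega) (by omega), Nat.zero_div]
  rw [secondTree, treeApexes_node, treeApexes_node, treeApexes_nil, treeApexes_zigzag,
    treeApexes_eq_zero (t := rightComb (p - 1)) (a := 0) (.inl ?_),
    treeApexes_eq_zero (t := rightComb (p - 1)) (a := _ + _) (.inr ?_)]
  · simp only [BinaryTree.numNodes, numNodes_rightComb, numNodes_zigzag, add_zero]
    congr 1
    · have e1 : 0 + (p - 1 + 0 + 1) + 1 = p + 1 := by omega
      have e2 : 0 + (p - 1 + 0 + 1) + (p - 1 + 2 * (m * p - p)) + 2 = 2 * (m * p) + 1 := by omega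
      have e3 : 0 + (p - 1) + 1 = p := by omega
      have e4 : 0 + (p - 1) + 2 = p + 1 := by omega
      have l0 := level_zero p (m * p)
      simp only [add_zero] at e1 e2
      rw [e1, e2, e3, e4, apexes_eq_second k (by omega), apexes_eq_third k (by omega)]
      congr 1
      · exact if_congr (by omega) rfl rfl
      · exact if_congr (by omega) rfl rfl
    · refine Finset.sum_congr rfl fun i hi => ?_
      rw [Finset.mem_range] at hi
      have e1 : 0 + (p - 1 + 1) + 1 + i = p + 1 + i := by omega
      have e2 : 0 + (p - 1 + 1) + 1 + (p - 1) + 2 * (m * p - p) + 1 - i = 2 * (m * p) + 1 - i := by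
        omega
      have e3 : 0 + (p - 1 + 1) + 1 + (p - 1) + 2 * (m * p - p) - i = 2 * (m * p) - i := by omega
      have e4 : p + 1 + i + 1 = p + 2 + i := by omega
      rw [e1, e2, e3, e4]
      have l1 : level p (m * p) (p + 1 + i) = 2 * (i / p) + 3 := by
        rw [show p + 1 + i = i + p + 1 by omega, level_left (by omega), Nat.add_div_right _ hp]
        omega
      have l2 : level p (m * p) (p + 2 + i) = 2 * ((i + 1) / p) + 3 := by
        rw [show p + 2 + i = i + 1 + p + 1 by omega, level_left (by omega),
          Nat.add_div_right _ hp]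
        omega
      have l3 : level p (m * p) (2 * (m * p) + 1 - i) = 2 * (i / p) + 2 :=
        level_right (by omega) rfl
      have l4 : level p (m * p) (2 * (m * p) - i) = 2 * ((i + 1) / p) + 2 :=
        level_right (by omega) (by omega)
      congr 1
      · rcases succ_div_eq_or p i with ⟨h, h'⟩ | ⟨h, h'⟩
        · rw [apexes_eq_second k (by omega)]
          refine if_congr ?_ rfl rfl
          simp only [h, and_true]
          omega
        · rw [if_neg (by simp [h])]
          exact apexes_eq_zero_of_tie k (by omega)
      · have := Nat.div_le_div_right (c := p) (show i ≤ i + 1 by omega)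
        rw [apexes_eq_first k (by omega)]
        exact if_congr (by omega) rfl rfl
  · intro v hv hv'
    rw [numNodes_rightComb] at *
    simp only [BinaryTree.numNodes, numNodes_rightComb] at hv hv'
    rcases Nat.lt_or_ge (m * p + 1) v with h | h
    · rw [level_right (v := v) (t := 2 * (m * p) + 1 - v) (by omega) (by omega)]
      have h1 : (m - 1) * p ≤ 2 * (m * p) + 1 - v := by
        rw [Nat.sub_mul, one_mul]
        omega
      have h2 := (Nat.le_div_iff_mul_le hp).mpr h1
      omega
    · obtain rfl : v = m * p + 1 := by omega
      rw [level_left le_rfl, Nat.mul_div_cancel _ hp]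
      omega
  · intro v _ hv
    rw [numNodes_rightComb] at hv
    rcases Nat.eq_zero_or_pos v with rfl | hv0
    · rw [level_zero]
      omega
    · obtain ⟨j, rfl⟩ : ∃ j, v = j + 1 := ⟨v - 1, by omega⟩
      rw [level_left (by omega), Nat.div_eq_of_lt (by omega)]
      omega

/-- The element excluded from the distinct apexes of level `k`. -/
def excluded (p N k : ℕ) : ℕ :=
  if k % 2 = 1 then (k / 2 + 1) * p + 1 else 2 * N + 1 - k / 2 * p

theorem le_abs_weight_sub {p m k : ℕ} (hp : 0 < p) (hk : 0 < k) (hkm : k < 2 * m) :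
    (2 * p - 1 : ℤ) ≤
      |(weight (excluded p (m * p) k) (treeApexes (level p (m * p)) k (firstTree (m * p)) 0) : ℤ) -
        weight (excluded p (m * p) k)
          (treeApexes (level p (m * p)) k (secondTree p (m * p)) 0)| := by
  have hm : 0 < m := by omega
  rw [treeApexes_firstTree hp hkm, treeApexes_secondTree hp hm hk hkm]
  obtain ⟨c, rfl | rfl⟩ : ∃ c, k = 2 * c + 1 ∨ k = 2 * c + 2 := ⟨(k - 1) / 2, by omega⟩
  · have hy : excluded p (m * p) (2 * c + 1) = (c + 1) * p + 1 := by
      rw [excluded, if_pos (by omega), show (2 * c + 1) / 2 = c by omega]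
    have hcm : (c + 1) * p ≤ m * p := Nat.mul_le_mul_right p (by omega)
    have hcp : (c + 1) * p = c * p + p := by ring
    rw [hy]
    have h1 : ∀ C : Multiset ℕ, C = ∑ i ∈ Finset.range (m * p),
        ((if 2 * (i / p) + 1 = 2 * c + 1 then {2 * (m * p) + 1 - i} else 0) +
          if 2 * (i / p) + 2 = 2 * c + 1 ∧ p ∣ i + 1 then {2 * (m * p) - i} else 0) →
        2 * p ≤ weight ((c + 1) * p + 1) C := by
      rintro C rfl
      -- Odd level: the first tree has the right block c as apexes, the second one only the first
      -- vertex of the left block c + 1.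
      apply two_mul_le_weight (f := fun s => 2 * (m * p) + 1 - (c * p + s))
      · intro s hs s' hs' h
        simp only [Finset.coe_range, Set.mem_Iio] at hs hs' h
        omega
      · intro s hs
        refine ⟨?_, by omega⟩
        rw [Multiset.mem_sum]
        refine ⟨c * p + s, Finset.mem_range.mpr (by omega), ?_⟩
        have : (c * p + s) / p = c := by
          rw [add_comm, Nat.add_mul_div_right _ _ hp, Nat.div_eq_of_lt hs, zero_add]
        rw [this, if_pos rfl]
        simp
    have h2 : (if 2 * c + 1 = 2 then {p + 1} else 0) + (if 2 * c + 1 = 1 then {p + 1} else 0) +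
        ∑ i ∈ Finset.range (m * p - p),
        ((if 2 * (i / p) + 3 = 2 * c + 1 ∧ p ∣ i + 1 then {p + 2 + i} else 0) +
          if 2 * ((i + 1) / p) + 2 = 2 * c + 1 then {p + 2 + i} else 0) =
        ({(c + 1) * p + 1} : Multiset ℕ) := by
      rw [if_neg (by omega), zero_add]
      rcases Nat.eq_zero_or_pos c with rfl | hc
      · rw [if_pos rfl, Finset.sum_eq_zero, add_zero]
        · simp
        · intro i _
          rw [if_neg (by omega), if_neg (by omega), add_zero]
      · obtain ⟨d, rfl⟩ : ∃ d, c = d + 1 := ⟨c - 1, by omega⟩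
        have h0 : 0 < (d + 1) * p := by positivity
        rw [if_neg (by omega), zero_add,
          Finset.sum_eq_single_of_mem ((d + 1) * p - 1) (Finset.mem_range.mpr (by omega))]
        · have h := (div_eq_and_dvd_iff (c := d) hp).mpr (Eq.refl ((d + 1) * p - 1))
          rw [if_pos ⟨by omega, h.2⟩, if_neg (by omega), add_zero]
          congr 1
          omega
        · intro i _ hi
          rw [if_neg ?_, if_neg (by omega), add_zero]
          rintro ⟨h, h'⟩
          exact hi ((div_eq_and_dvd_iff hp).mp ⟨by omega, h'⟩)
    rw [h2, weight_singleton]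
    have h3 := h1 _ rfl
    refine le_trans ?_ (le_abs_self _)
    omega
  · have hy : excluded p (m * p) (2 * c + 2) = 2 * (m * p) + 1 - (c + 1) * p := by
      rw [excluded, if_neg (by omega), show (2 * c + 2) / 2 = c + 1 by omega]
    have hcm : (c + 2) * p ≤ m * p := Nat.mul_le_mul_right p (by omega)
    have hcp : (c + 1) * p = c * p + p := by ring
    have hcp' : (c + 2) * p = c * p + p + p := by ring
    rw [hy]
    have h1 : ∀ C : Multiset ℕ, C = (if 2 * c + 2 = 2 then {p + 1} else 0) +
        (if 2 * c + 2 = 1 then {p + 1} else 0) + ∑ i ∈ Finset.range (m * p - p),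
        ((if 2 * (i / p) + 3 = 2 * c + 2 ∧ p ∣ i + 1 then {p + 2 + i} else 0) +
          if 2 * ((i + 1) / p) + 2 = 2 * c + 2 then {p + 2 + i} else 0) →
        2 * p ≤ weight (2 * (m * p) + 1 - (c + 1) * p) C := by
      rintro C rfl
      -- Even level: the second tree has the left block c + 1 as apexes, the first one only the
      -- first vertex of the right block c + 1.
      apply two_mul_le_weight (f := fun s => p + 1 + (c * p + s))
      · intro s hs s' hs' h
        simp only at h
        omega
      · intro s hs
        refine ⟨?_, by omega⟩
        rcases Nat.eq_zero_or_pos (c * p + s) with h0 | h0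
        · have hc : c = 0 := by
            rcases Nat.eq_zero_or_pos c with h | h
            · exact h
            · have : 0 < c * p := by positivity
              omega
          -- The apex p + 1 of level 2 comes from the root triangle, not from the zigzag.
          rw [h0, if_pos (by omega)]
          simp
        · rw [Multiset.mem_add]
          right
          rw [Multiset.mem_sum]
          refine ⟨c * p + s - 1, Finset.mem_range.mpr (by omega), ?_⟩
          have : (c * p + s - 1 + 1) / p = c := by
            rw [Nat.sub_add_cancel h0, add_comm, Nat.add_mul_div_right _ _ hp,
              Nat.div_eq_of_lt hs, zero_add]
          rw [this, if_pos (c := 2 * c + 2 = 2 * c + 2) rfl, Multiset.mem_add]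
          right
          rw [Multiset.mem_singleton]
          omega
    have h2 : ∑ i ∈ Finset.range (m * p),
        ((if 2 * (i / p) + 1 = 2 * c + 2 then {2 * (m * p) + 1 - i} else 0) +
          if 2 * (i / p) + 2 = 2 * c + 2 ∧ p ∣ i + 1 then {2 * (m * p) - i} else 0) =
        ({2 * (m * p) + 1 - (c + 1) * p} : Multiset ℕ) := by
      have h0 : 0 < (c + 1) * p := by positivity
      rw [Finset.sum_eq_single_of_mem ((c + 1) * p - 1) (Finset.mem_range.mpr (by omega))]
      · have h := (div_eq_and_dvd_iff (c := c) hp).mpr (Eq.refl ((c + 1) * p - 1))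
        rw [if_neg (by omega), if_pos ⟨by omega, h.2⟩, zero_add]
        congr 1
        omega
      · intro i _ hi
        rw [if_neg (by omega), if_neg ?_, add_zero]
        rintro ⟨h, h'⟩
        exact hi ((div_eq_and_dvd_iff hp).mp ⟨by omega, h'⟩)
    rw [h2, weight_singleton, abs_sub_comm]
    have h3 := h1 _ rfl
    refine le_trans ?_ (le_abs_self _)
    omega

theorem mul_le_maxRotationDist {m p n : ℕ} (hp : 0 < p) (hm : 0 < m) (h : 2 * (m * p) ≤ n) :
    (2 * m - 1 : ℤ) * (2 * p - 1) ≤ maxRotationDist n := by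
  have hpm : p ≤ m * p := Nat.le_mul_of_pos_left p hm
  have hs := numNodes_firstTree (m * p)
  have ht := numNodes_secondTree hp hpm
  let s : SizedTree n := ⟨pad (firstTree (m * p)) (n - 2 * (m * p)), by
    rw [numNodes_pad, hs]
    omega⟩
  let t : SizedTree n := ⟨pad (secondTree p (m * p)) (n - 2 * (m * p)), by
    rw [numNodes_pad, ht]
    omega⟩
  have key := sum_abs_weight_le_rotationDist (unimodal_level p (m * p)) (excluded p (m * p))
    (Finset.Ico 1 (2 * m)) s t
  have hle : (rotationDist s t : ℤ) ≤ maxRotationDist n := by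
    exact_mod_cast rotationDist_le_maxRotationDist s t
  refine le_trans ?_ (key.trans hle)
  have hc := Finset.card_nsmul_le_sum (Finset.Ico 1 (2 * m))
    (fun k => |(weight (excluded p (m * p) k) (treeApexes (level p (m * p)) k s.1 0) : ℤ) -
      weight (excluded p (m * p) k) (treeApexes (level p (m * p)) k t.1 0)|) (2 * p - 1) ?_
  · rw [Nat.card_Ico, nsmul_eq_mul, Nat.cast_sub (by omega)] at hc
    push_cast at hc
    exact hc
  · intro k hk
    rw [Finset.mem_Ico] at hk
    have h1 : treeApexes (level p (m * p)) k s.1 0 =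
        treeApexes (level p (m * p)) k (firstTree (m * p)) 0 :=
      treeApexes_pad hk.1 (level_zero _ _) (fun v hv => level_of_lt (by omega)) _
    have h2 : treeApexes (level p (m * p)) k t.1 0 =
        treeApexes (level p (m * p)) k (secondTree p (m * p)) 0 :=
      treeApexes_pad hk.1 (level_zero _ _) (fun v hv => level_of_lt (by omega)) _
    simp only [h1, h2]
    exact le_abs_weight_sub hp hk.1 hk.2

end RotationDistance

/-! ### Choice of the block length and the number of blocks -/

theorem corollaryC (n : ℕ) (hn : 1 ≤ n) :
    (∀ m : ℕ, n = 2 * m ^ 2 →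
      (RotationDistance.maxRotationDist n : ℝ) ≥ 2 * (n : ℝ) - 2 * Real.sqrt (2 * (n : ℝ)) + 1) ∧
    (RotationDistance.maxRotationDist n : ℝ) ≥
      2 * (n : ℝ) - Real.sqrt 70 * Real.sqrt (n : ℝ) := by
  constructor
  · rintro m rfl
    have hm : 0 < m := by
      rcases Nat.eq_zero_or_pos m with rfl | h
      · simp at hn
      · exact h
    have h := RotationDistance.mul_le_maxRotationDist (n := 2 * m ^ 2) hm hm (by rw [sq])
    have h' : ((2 * m - 1 : ℝ)) * (2 * m - 1) ≤ RotationDistance.maxRotationDist (2 * m ^ 2) := by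
      exact_mod_cast h
    have hsq : Real.sqrt (2 * ((2 * m ^ 2 : ℕ) : ℝ)) = 2 * m := by
      rw [show (2 * ((2 * m ^ 2 : ℕ) : ℝ)) = (2 * m) ^ 2 by push_cast; ring]
      exact Real.sqrt_sq (by positivity)
    rw [hsq]
    push_cast
    nlinarith
  · have h70 : (8 : ℝ) ≤ Real.sqrt 70 := Real.le_sqrt_of_sq_le (by norm_num)
    have hr : Real.sqrt (n : ℝ) ^ 2 = n := Real.sq_sqrt (Nat.cast_nonneg n)
    have hr0 : 0 ≤ Real.sqrt (n : ℝ) := Real.sqrt_nonneg _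
    rcases Nat.lt_or_ge n 16 with hn' | hn'
    -- For n < 16 the bound is not positive, since 2n ≤ 8√n.
    · have h4 : Real.sqrt (n : ℝ) ≤ 4 := by
        rw [Real.sqrt_le_left (by norm_num)]
        norm_num
        exact_mod_cast hn'.le
      have h0 : (0 : ℝ) ≤ RotationDistance.maxRotationDist n := Nat.cast_nonneg _
      nlinarith
    · set r := Real.sqrt (n : ℝ) with hrdef
      set q := Nat.sqrt n with hq
      have hq4 : 4 ≤ q := Nat.le_sqrt.mpr (by omega)
      have hqr : (q : ℝ) ≤ r := Real.nat_sqrt_le_real_sqrt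
      have hrq : r < q + 1 := Real.real_sqrt_lt_nat_sqrt_succ
      -- With 2m close to √n, the product 2mp misses n by less than 2m. The loss against 2n is then
      -- at most 6m + 2p ≤ 3r + 3r, which is below √70 r.
      set m := q / 2 with hmdef
      set p := n / (2 * m) with hpdef
      have hm2 : 2 ≤ m := by omega
      have hqm : q ≤ 2 * m + 1 := by omega
      have hmq : 2 * m ≤ q := by omega
      have hp : 0 < p := Nat.div_pos (by
        have : q ≤ n := Nat.sqrt_le_self n
        omega) (by omega)
      have hdiv := Nat.div_add_mod n (2 * m)
      have hmod := Nat.mod_lt n (show 2 * m > 0 by omega)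
      rw [← hpdef] at hdiv
      have hle : 2 * m * p ≤ n := by omega
      have hlt : n < 2 * m * p + 2 * m := by omega
      have h := RotationDistance.mul_le_maxRotationDist (n := n) hp (by omega : 0 < m)
        (by rw [← mul_assoc]; exact hle)
      have h' : ((2 * m - 1 : ℝ)) * (2 * p - 1) ≤ RotationDistance.maxRotationDist n := by
        exact_mod_cast h
      have a1 : (2 * m * p : ℝ) ≤ n := by exact_mod_cast hle
      have a2 : (n : ℝ) ≤ 2 * m * p + 2 * m := by exact_mod_cast hlt.le
      have a3 : (2 : ℝ) ≤ m := by exact_mod_cast hm2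
      have a4 : (q : ℝ) ≤ 2 * m + 1 := by exact_mod_cast hqm
      have a5 : (2 * m : ℝ) ≤ q := by exact_mod_cast hmq
      have a6 : (m : ℝ) * (2 * p) ≤ m * (3 * r) := by
        have : r ≤ 3 * m := by linarith
        nlinarith
      have a7 : (2 * p : ℝ) ≤ 3 * r := le_of_mul_le_mul_left a6 (by linarith)
      have a8 : 8 * r ≤ Real.sqrt 70 * r := mul_le_mul_of_nonneg_right h70 hr0
      nlinarith
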